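/- Let $\mathcal X\subset\mathbb R^d$ be compact. For each group $\ell=1,2$ let $x_{\ell,1},\dots,x_{\ell,k_\ell}\in\mathcal X$ be fixed design points, let $m_\ell(x,b)$ be a regression function with true parameter $\beta_\ell\in B_\ell$, where $B_\ell\subset\mathbb R^{p_\ell}$ is compact, and observe $$Y_{\ell,i,j}=m_\ell(x_{\ell,i},\beta_\ell)+\eta_{\ell,i,j},\qquad j=1,\dots,n_{\ell,i},\ i=1,\dots,k_\ell,$$ where all errors $\eta_{\ell,i,j}$ are independent and, within each group $\ell$, identically distributed with mean $0$ and finite variance $\sigma_\ell^2>0$. Put $n_\ell=\sum_{i=1}^{k_\ell}n_{\ell,i}$ and $n=n_1+n_2$, and consider a sequence of sample sizes $(n_{\ell,i})$ along which, for $\ell=1,2$, $n_\ell\to\infty$ and $n_{\ell,i}/n_\ell\to\zeta_{\ell,i}>0$ $(i=1,\dots,k_\ell)$, and $n/n_1\to\kappa\in(1,\infty)$; limits below are along this sequence. Write $\nabla m_\ell(x,\beta_\ell)$ for the gradient of $b\mapsto m_\ell(x,b)$ at $\beta_\ell$, and $$\Sigma_\ell=\frac1{\sigma_\ell^2}\sum_{i=1}^{k_\ell}\zeta_{\ell,i}\,\nabla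 m_\ell(x_{\ell,i},\beta_\ell)\,\nabla m_\ell(x_{\ell,i},\beta_\ell)^\top .$$ Assume for $\ell=1,2$: (a) $m_\ell$ is continuous on $\mathcal X\times B_\ell$, and there is an open neighbourhood $U_\ell$ of $\beta_\ell$ such that $m_\ell(x,\cdot)$ is twice continuously differentiable on $U_\ell$ for each $x\in\mathcal X$, and $m_\ell$ and its first two derivatives with respect to the parameter are jointly continuous on $\mathcal X\times U_\ell$. (b) For every $u>0$ there is $v_{u,\ell}>0$ with $$\liminf\ \inf_{a\in B_\ell}\ \inf_{b\in B_\ell,\ |b-a|\ge u}\ \sum_{i=1}^{k_\ell}\frac{n_{\ell,i}}{n_\ell}\bigl(m_\ell(x_{\ell,i},a)-m_\ell(x_{\ell,i},b)\bigr)^2\ \ge\ v_{u,\ell}$$ (an infimum over the empty set is $\infty$). (c) $\Sigma_\ell$ is non-singular. (d) $\hat\beta_\ell$ is a measurable function of the sample $(Y_{\ell,i,j})_{i,j}$ of group $\ell$ with values in $B_\ell$, and $$\sqrt{n_\ell}(\hat\beta_\ell-\beta_\ell)=\frac1{\sqrt{n_\ell}}\sum_{i=1}^{k_\ell}\sum_{j=1}^{n_{\ell,i}}\phi_{\ell,i,j}+o_{\mathbb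 P}(1),$$ where $\phi_{\ell,i,j}$ is a measurable $\mathbb R^{p_\ell}$-valued function of $Y_{\ell,i,j}$ (not depending on the sample sizes) whose law does not depend on $j$, is square integrable, satisfies $\mathbb E[\phi_{\ell,i,j}]=0$, and $\Sigma_\ell^{-1}=\sum_{i=1}^{k_\ell}\zeta_{\ell,i}\,\mathbb E[\phi_{\ell,i,j}\phi_{\ell,i,j}^\top]$. Let $d_1=\int_{\mathcal X}|m_1(x,\beta_1)-m_2(x,\beta_2)|\,dx$, let $\hat d_1=\int_{\mathcal X}|m_1(x,\hat\beta_1)-m_2(x,\hat\beta_2)|\,dx$, and let $\mathcal N=\{x\in\mathcal X: m_1(x,\beta_1)=m_2(x,\beta_2)\}$, $\mathcal N^c=\mathcal X\setminus\mathcal N$. Let $Z_1,Z_2$ be independent standard normal random vectors of dimensions $p_1,p_2$. Then $$G(x)=\nabla m_1(x,\beta_1)^\top\sqrt{\kappa}\,\Sigma_1^{-1/2}Z_1-\nabla m_2(x,\beta_2)^\top\sqrt{\tfrac{\kappa}{\kappa-1}}\,\Sigma_2^{-1/2}Z_2,\qquad x\in\mathcal X,$$ is a centred Gaussian process with bounded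 paths, and $\sqrt n(\hat d_1-d_1)$ converges in distribution to $$T=\int_{\mathcal N^c}\operatorname{sgn}\bigl(m_1(x,\beta_1)-m_2(x,\beta_2)\bigr)\,G(x)\,dx+\int_{\mathcal N}|G(x)|\,dx .$$ -/

import Mathlib

open MeasureTheory ProbabilityTheory Filter Topology
open scoped ENNReal MatrixOrder

noncomputable section

/-- Euclidean space of dimension `n`. -/
abbrev Vec (n : ℕ) : Type := EuclideanSpace ℝ (Fin n)

/-- The size of a sample that has `N i` observations at the `i`-th design point. -/
def sampleSize {k : ℕ} (N : Fin k → ℕ) : ℕ := ∑ i, N i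

/-- The `L¹` distance over `X` of the curves `m₁(·, b₁)` and `m₂(·, b₂)`. -/
def areaBetween {d p₁ p₂ : ℕ} (X : Set (Vec d))
    (m₁ : Vec d → Vec p₁ → ℝ) (m₂ : Vec d → Vec p₂ → ℝ) (b₁ : Vec p₁) (b₂ : Vec p₂) : ℝ :=
  ∫ x in X, |m₁ x b₁ - m₂ x b₂|

/-- The set of points of `X` where the curves `m₁(·, b₁)` and `m₂(·, b₂)` coincide. -/
def coincidenceSet {d p₁ p₂ : ℕ} (X : Set (Vec d))
    (m₁ : Vec d → Vec p₁ → ℝ) (m₂ : Vec d → Vec p₂ → ℝ) (b₁ : Vec p₁) (b₂ : Vec p₂) :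
    Set (Vec d) :=
  {x ∈ X | m₁ x b₁ - m₂ x b₂ = 0}

/-- The matrix `σ⁻² ∑ᵢ ζᵢ ∇m(xᵢ, β) ∇m(xᵢ, β)ᵀ`, with gradients in the parameter. -/
def informationMatrix {d p k : ℕ} (m : Vec d → Vec p → ℝ) (x : Fin k → Vec d)
    (ζ : Fin k → ℝ) (σ : ℝ) (β : Vec p) : Matrix (Fin p) (Fin p) ℝ :=
  (1 / σ ^ 2) • ∑ i, ζ i •
    Matrix.vecMulVec (gradient (m (x i)) β).ofLp (gradient (m (x i)) β).ofLp

/-- The vector `S^{-1/2} z`, where `S^{-1/2}` is the positive semidefinite square root of the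
inverse of the (positive definite) matrix `S`. -/
def invSqrtApply {p : ℕ} (S : Matrix (Fin p) (Fin p) ℝ) (z : Vec p) : Vec p :=
  WithLp.toLp 2 ((CFC.sqrt S⁻¹).mulVec z.ofLp)

/-- The value `∇m₁(x, β₁)ᵀ √κ S₁^{-1/2} z₁ - ∇m₂(x, β₂)ᵀ √(κ / (κ - 1)) S₂^{-1/2} z₂`. -/
def limitCurve {d p₁ p₂ : ℕ} (m₁ : Vec d → Vec p₁ → ℝ) (m₂ : Vec d → Vec p₂ → ℝ)
    (β₁ : Vec p₁) (β₂ : Vec p₂) (S₁ : Matrix (Fin p₁) (Fin p₁) ℝ)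
    (S₂ : Matrix (Fin p₂) (Fin p₂) ℝ) (κ : ℝ) (z₁ : Vec p₁) (z₂ : Vec p₂) (x : Vec d) : ℝ :=
  inner ℝ (gradient (m₁ x) β₁) (√κ • invSqrtApply S₁ z₁) -
    inner ℝ (gradient (m₂ x) β₂) (√(κ / (κ - 1)) • invSqrtApply S₂ z₂)

/-- For a function `g` on `X`, the sum of the integral of `sgn(m₁ - m₂) g` over the complement
(in `X`) of the coincidence set and of the integral of `|g|` over the coincidence set. -/
def directionalArea {d p₁ p₂ : ℕ} (X : Set (Vec d))
    (m₁ : Vec d → Vec p₁ → ℝ) (m₂ : Vec d → Vec p₂ → ℝ) (β₁ : Vec p₁) (β₂ : Vec p₂)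
    (g : Vec d → ℝ) : ℝ :=
  (∫ x in X \ coincidenceSet X m₁ m₂ β₁ β₂, Real.sign (m₁ x β₁ - m₂ x β₂) * g x) +
    ∫ x in coincidenceSet X m₁ m₂ β₁ β₂, |g x|

/-- Regularity of a regression function: `m` is continuous on `X × B`, and there is an open
neighbourhood `U` of the parameter `β` such that `m(x, ·)` is twice continuously differentiable
on `U` for every `x ∈ X`, and `m` and its first two derivatives with respect to the parameter
are jointly continuous on `X × U`. -/
structure IsRegularRegression {d p : ℕ} (X : Set (Vec d)) (B : Set (Vec p)) (β : Vec p)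
    (m : Vec d → Vec p → ℝ) : Prop where
  continuousOn : ContinuousOn (fun q : Vec d × Vec p => m q.1 q.2) (X ×ˢ B)
  smooth_near : ∃ U : Set (Vec p), IsOpen U ∧ β ∈ U ∧
    (∀ x ∈ X, ContDiffOn ℝ 2 (m x) U) ∧
    ContinuousOn (fun q : Vec d × Vec p => m q.1 q.2) (X ×ˢ U) ∧
    ContinuousOn (fun q : Vec d × Vec p => fderiv ℝ (m q.1) q.2) (X ×ˢ U) ∧
    ContinuousOn (fun q : Vec d × Vec p => fderiv ℝ (fderiv ℝ (m q.1)) q.2) (X ×ˢ U)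

/-- The discrepancy `∑ᵢ (Nᵢ / ∑ⱼ Nⱼ) (m(xᵢ, a) - m(xᵢ, b))²`. -/
def discrepancy {d p k : ℕ} (m : Vec d → Vec p → ℝ) (x : Fin k → Vec d) (N : Fin k → ℕ)
    (a b : Vec p) : ℝ :=
  ∑ i, ((N i : ℝ) / (sampleSize N : ℝ)) * (m (x i) a - m (x i) b) ^ 2

/-- Asymptotic identifiability of the parameter along the allocations `N r`, `r → ∞`. The
infima are taken in `[0, ∞]`, so that an infimum over the empty set is `∞`. -/
def IsIdentifiable {d p k : ℕ} (B : Set (Vec p)) (m : Vec d → Vec p → ℝ) (x : Fin k → Vec d)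
    (N : ℕ → Fin k → ℕ) : Prop :=
  ∀ u : ℝ, 0 < u → ∃ v : ℝ, 0 < v ∧
    ENNReal.ofReal v ≤
      liminf (fun r => ⨅ a ∈ B, ⨅ b ∈ B, ⨅ _ : u ≤ ‖b - a‖,
        ENNReal.ofReal (discrepancy m x (N r) a b)) atTop

/-- The observation with error `e` at the design point `x` of the regression model. -/
def response {d p : ℕ} (m : Vec d → Vec p → ℝ) (β : Vec p) (x : Vec d) (e : ℝ) : ℝ :=
  m x β + e

/-- The estimators `est r`, computed from the sample of the first `N r i` observations `Y i j`
at each design point `i`, are asymptotically linear at `β` with the influence functions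
`φ i j`, whose value at the observation `Y i j` is square integrable and centred, with a
law that does not depend on `j`. The limiting covariance matrix is `V`. -/
structure IsAsymptoticallyLinear {Ω : Type*} [MeasurableSpace Ω] (P : Measure Ω) {p k : ℕ}
    (Y : Fin k → ℕ → Ω → ℝ) (N : ℕ → Fin k → ℕ) (ζ : Fin k → ℝ) (β : Vec p)
    (est : (r : ℕ) → ((i : Fin k) → Fin (N r i) → ℝ) → Vec p)
    (φ : Fin k → ℕ → ℝ → Vec p) (V : Matrix (Fin p) (Fin p) ℝ) : Prop where
  measurable : ∀ i j, Measurable (φ i j)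
  identDistrib : ∀ i j j',
    IdentDistrib (fun ω => φ i j (Y i j ω)) (fun ω => φ i j' (Y i j' ω)) P P
  memLp : ∀ i j, MemLp (fun ω => φ i j (Y i j ω)) 2 P
  centred : ∀ i j, ∫ ω, φ i j (Y i j ω) ∂P = 0
  covariance : ∀ j, V = ∑ i, ζ i •
    Matrix.of (fun a b => ∫ ω, φ i j (Y i j ω) a * φ i j (Y i j ω) b ∂P)
  linearization : TendstoInMeasure P
    (fun r ω =>
      √(sampleSize (N r) : ℝ) • (est r (fun i j => Y i j ω) - β) -
        (1 / √(sampleSize (N r) : ℝ)) •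
          ∑ i, ∑ j ∈ Finset.range (N r i), φ i j (Y i j ω))
    atTop (fun _ => 0)

end

/-!
The estimated area `∫ |m₁(x, b₁) - m₂(x, b₂)| dx` is a function `F` of the pair of parameters, so
its limit law follows from a delta method. The pair lives in the `ℓ²` direct sum
`PiLp 2 (fun ℓ => Vec (p ℓ))`, a finite-dimensional Euclidean space.

* `F` is not differentiable when the curves coincide on a set of positive measure, but it is
  directionally differentiable: `F (β + v) = F β + D v + o(‖v‖)` with `D` continuous and positively
  homogeneous (`isLittleO_areaBetween`). Pointwise in `x` this is the chain rule with the one-sided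
  derivative `absDeriv` of the absolute value; the remainders are `O(‖v‖)` uniformly in `x`,
  because the gradients of the curves are bounded near the true parameter, so dominated
  convergence applies.
* The rescaled errors `√n (β̂ - β)` of both groups converge jointly to independent Gaussian
  vectors. By the linearization it suffices to treat the sums of the influence functions
  (`tendstoInDistribution_influence_sums`). Their joint characteristic function factors over the
  groups, the design points and the observations, and the one-dimensional central limit theorem
  gives the limit of each block of identically distributed factors
  (`tendsto_charFun_sum_blocks`); Lévy's theorem concludes.
* Positive homogeneity and tightness give `√n (F β̂ - F β) = D (√n (β̂ - β)) + o_P(1)`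
  (`tendstoInDistribution_delta_method`), and `D` is continuous. Its value at the Gaussian limit is
  the `directionalArea` of the limit process, which is a random linear form of the gradients and
  hence a Gaussian process with bounded paths.

Consistency of the estimators is a consequence of the linearization here, since `√n (β̂ - β)` is
tight.
-/

/-! ### Differentiating the `L¹` norm -/

/-- The one-sided directional derivative of `|·|` at `a` in the direction `y`. -/
noncomputable def absDeriv (a y : ℝ) : ℝ := if a = 0 then |y| else Real.sign a * y

lemma abs_real_sign_le_one (a : ℝ) : |Real.sign a| ≤ 1 := by
  rcases Real.sign_apply_eq a with h | h | h <;> simp [h]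

lemma abs_absDeriv_sub_le (a y z : ℝ) : |absDeriv a y - absDeriv a z| ≤ |y - z| := by
  unfold absDeriv
  split_ifs
  · exact abs_abs_sub_abs_le_abs_sub y z
  · rw [← mul_sub, abs_mul]
    exact mul_le_of_le_one_left (abs_nonneg _) (abs_real_sign_le_one a)

@[simp] lemma absDeriv_zero_right (a : ℝ) : absDeriv a 0 = 0 := by simp [absDeriv]

lemma abs_absDeriv_le (a y : ℝ) : |absDeriv a y| ≤ |y| := by
  simpa using abs_absDeriv_sub_le a y 0

lemma absDeriv_mul_of_nonneg (a y : ℝ) {c : ℝ} (hc : 0 ≤ c) :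
    absDeriv a (c * y) = c * absDeriv a y := by
  unfold absDeriv
  split_ifs
  · rw [abs_mul, abs_of_nonneg hc]
  · ring

lemma measurable_real_sign : Measurable Real.sign := by
  unfold Real.sign
  exact Measurable.ite measurableSet_Iio measurable_const
    (Measurable.ite measurableSet_Ioi measurable_const measurable_const)

lemma measurable_absDeriv : Measurable (fun q : ℝ × ℝ => absDeriv q.1 q.2) := by
  unfold absDeriv
  exact Measurable.ite (measurable_fst (measurableSet_singleton 0)) measurable_snd.abs
    ((measurable_real_sign.comp measurable_fst).mul measurable_snd)

lemma aestronglyMeasurable_absDeriv {α : Type*} [MeasurableSpace α] {μ : Measure α} {f g : α → ℝ}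
    (hf : AEStronglyMeasurable f μ) (hg : AEStronglyMeasurable g μ) :
    AEStronglyMeasurable (fun x => absDeriv (f x) (g x)) μ :=
  (measurable_absDeriv.comp_aemeasurable
    (hf.aemeasurable.prodMk hg.aemeasurable)).aestronglyMeasurable

section

variable {E : Type*} [NormedAddCommGroup E] [NormedSpace ℝ E]

/-- The chain rule for `|f|`, which holds also at a zero of `f` if the derivative of the absolute
value is replaced by its one-sided directional derivative. -/
lemma isLittleO_abs_sub_absDeriv {f : E → ℝ} {L : E →L[ℝ] ℝ} (hf : HasFDerivAt f L 0) :
    (fun v => |f v| - |f 0| - absDeriv (f 0) (L v)) =o[𝓝 0] (fun v => v) := by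
  rcases lt_trichotomy (f 0) 0 with h | h | h
  · have := ((hasDerivAt_abs_neg h).comp_hasFDerivAt (0 : E) hf).isLittleO
    simpa [absDeriv, h.ne, Real.sign_of_neg h] using this
  · have hf' : (fun v => f v - f 0 - L v) =o[𝓝 0] (fun v => v) := by simpa using hf.isLittleO
    refine Asymptotics.IsBigO.trans_isLittleO (Asymptotics.isBigO_of_le _ fun v => ?_) hf'
    simpa [absDeriv, h] using abs_abs_sub_abs_le_abs_sub (f v) (L v)
  · have := ((hasDerivAt_abs_pos h).comp_hasFDerivAt (0 : E) hf).isLittleO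
    simpa [absDeriv, h.ne', Real.sign_of_pos h] using this

/-- Directional differentiability of the `L¹` norm along a family `f v` that is differentiable
pointwise at `v = 0` and Lipschitz there, uniformly on the space. The Lipschitz bound dominates
the difference quotients. -/
lemma isLittleO_integral_abs {α : Type*} [MeasurableSpace α] {μ : Measure α} [IsFiniteMeasure μ]
    {f : E → α → ℝ} {L : α → E →L[ℝ] ℝ} {C : ℝ}
    (hf : ∀ᶠ v in 𝓝 0, AEStronglyMeasurable (f v) μ)
    (hf₀ : Integrable (f 0) μ)
    (hL : ∀ v, AEStronglyMeasurable (fun x => L x v) μ)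
    (hLC : ∀ᵐ x ∂μ, ‖L x‖ ≤ C)
    (hderiv : ∀ᵐ x ∂μ, HasFDerivAt (fun v => f v x) (L x) 0)
    (hlip : ∀ᶠ v in 𝓝 0, ∀ᵐ x ∂μ, |f v x - f 0 x| ≤ C * ‖v‖) :
    (fun v => (∫ x, |f v x| ∂μ) - (∫ x, |f 0 x| ∂μ) - ∫ x, absDeriv (f 0 x) (L x v) ∂μ)
      =o[𝓝 0] (fun v => v) := by
  rw [← Asymptotics.isLittleO_norm_right]
  have hLv : ∀ v, ∀ᵐ x ∂μ, |absDeriv (f 0 x) (L x v)| ≤ C * ‖v‖ := fun v => by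
    filter_upwards [hLC] with x hx
    exact (abs_absDeriv_le _ _).trans ((L x).le_of_opNorm_le hx v)
  have hmeasD : ∀ v, AEStronglyMeasurable (fun x => absDeriv (f 0 x) (L x v)) μ := fun v =>
    aestronglyMeasurable_absDeriv hf₀.aestronglyMeasurable (hL v)
  have hintD : ∀ v, Integrable (fun x => absDeriv (f 0 x) (L x v)) μ := fun v =>
    Integrable.of_bound (hmeasD v) (C * ‖v‖) (hLv v)
  have hint : ∀ᶠ v in 𝓝 0, Integrable (f v) μ := by
    filter_upwards [hf, hlip] with v hv hvl
    have : Integrable (fun x => f v x - f 0 x) μ :=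
      Integrable.of_bound (hv.sub hf₀.aestronglyMeasurable) (C * ‖v‖) hvl
    exact (this.add hf₀).congr (.of_forall fun x => by simp)
  have hEq : ∀ᶠ v in 𝓝 0,
      (∫ x, |f v x| ∂μ) - (∫ x, |f 0 x| ∂μ) - ∫ x, absDeriv (f 0 x) (L x v) ∂μ =
        ∫ x, (|f v x| - |f 0 x| - absDeriv (f 0 x) (L x v)) ∂μ := by
    filter_upwards [hint] with v hv
    have h := integral_sub (hv.abs.sub hf₀.abs) (hintD v)
    simp only [Pi.sub_apply] at h
    rw [h, integral_sub hv.abs hf₀.abs]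
  refine Asymptotics.IsLittleO.congr' ?_ (hEq.mono fun _ h => h.symm) EventuallyEq.rfl
  have hzero : ∀ v : E, ‖v‖ = 0 →
      ∫ x, (|f v x| - |f 0 x| - absDeriv (f 0 x) (L x v)) ∂μ = 0 := fun v hv => by
    simp [norm_eq_zero.1 hv]
  rw [Asymptotics.isLittleO_iff_tendsto hzero]
  simp_rw [← integral_div]
  rw [← integral_zero α ℝ (μ := μ)]
  refine tendsto_integral_filter_of_dominated_convergence (fun _ => 2 * |C|) ?_ ?_
    (integrable_const _) ?_
  · filter_upwards [hf] with v hv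
    have h1 : AEStronglyMeasurable (fun x => |f v x|) μ := hv.norm
    have h2 : AEStronglyMeasurable (fun x => |f 0 x|) μ := hf₀.abs.aestronglyMeasurable
    exact (((h1.sub h2).sub (hmeasD v)).aemeasurable.div_const _).aestronglyMeasurable
  · filter_upwards [hlip] with v hv
    filter_upwards [hv, hLv v] with x hx hx'
    rw [Real.norm_eq_abs, abs_div, abs_norm]
    refine div_le_of_le_mul₀ (norm_nonneg _) (by positivity) ?_
    have h1 : |(|f v x| - |f 0 x| - absDeriv (f 0 x) (L x v))| ≤ C * ‖v‖ + C * ‖v‖ :=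
      (abs_sub _ _).trans (add_le_add ((abs_abs_sub_abs_le_abs_sub _ _).trans hx) hx')
    have h2 : C * ‖v‖ ≤ |C| * ‖v‖ := mul_le_mul_of_nonneg_right (le_abs_self C) (norm_nonneg v)
    linarith
  · filter_upwards [hderiv] with x hx
    have := (isLittleO_abs_sub_absDeriv hx).norm_right
    exact this.tendsto_div_nhds_zero

/-- The directional derivative of the `L¹` norm is continuous in the direction. -/
lemma continuous_integral_absDeriv {α : Type*} [MeasurableSpace α] {μ : Measure α}
    [IsFiniteMeasure μ] {a : α → ℝ} {L : α → E →L[ℝ] ℝ} {C : ℝ}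
    (ha : AEStronglyMeasurable a μ) (hL : ∀ v, AEStronglyMeasurable (fun x => L x v) μ)
    (hLC : ∀ᵐ x ∂μ, ‖L x‖ ≤ C) :
    Continuous (fun v => ∫ x, absDeriv (a x) (L x v) ∂μ) := by
  refine continuous_iff_continuousAt.2 fun v₀ => ?_
  refine tendsto_integral_filter_of_dominated_convergence (fun _ => |C| * (‖v₀‖ + 1)) ?_ ?_
    (integrable_const _) ?_
  · exact .of_forall fun v => aestronglyMeasurable_absDeriv ha (hL v)
  · have : ∀ᶠ v in 𝓝 v₀, ‖v‖ < ‖v₀‖ + 1 :=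
      continuous_norm.continuousAt.eventually_lt_const (lt_add_one _)
    filter_upwards [this] with v hv
    filter_upwards [hLC] with x hx
    refine (abs_absDeriv_le _ _).trans (((L x).le_of_opNorm_le hx v).trans ?_)
    exact mul_le_mul (le_abs_self C) hv.le (norm_nonneg _) (abs_nonneg _)
  · refine .of_forall fun x => ?_
    have h : Tendsto (fun v => L x v - L x v₀) (𝓝 v₀) (𝓝 0) := by
      simpa using ((L x).continuous.tendsto v₀).sub_const (L x v₀)
    rw [tendsto_iff_norm_sub_tendsto_zero]
    exact squeeze_zero (fun _ => norm_nonneg _) (fun v => abs_absDeriv_sub_le _ _ _)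
      (by simpa using h.abs)

end

/-! ### Convergence in distribution -/

/-- A sequence that converges in distribution is asymptotically tight. -/
lemma exists_eventually_measure_norm_ge_lt {Ω Ω' E : Type*} [MeasurableSpace Ω]
    {P : Measure Ω} [IsProbabilityMeasure P] [MeasurableSpace Ω'] {P' : Measure Ω'}
    [IsProbabilityMeasure P'] [NormedAddCommGroup E] [MeasurableSpace E] [BorelSpace E]
    {V : ℕ → Ω → E} {W : Ω' → E}
    (h : TendstoInDistribution V atTop W (fun _ => P) P') {δ : ℝ≥0∞} (hδ : 0 < δ) :
    ∃ K : ℝ, 0 < K ∧ ∀ᶠ r in atTop, P {ω | K ≤ ‖V r ω‖} < δ := by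
  have hclosed : ∀ K : ℝ, IsClosed {v : E | K ≤ ‖v‖} := fun K =>
    isClosed_le continuous_const continuous_norm
  have hlim : Tendsto (fun K : ℕ => (P'.map W) {v : E | (K : ℝ) ≤ ‖v‖}) atTop (𝓝 0) := by
    have hanti : Antitone (fun K : ℕ => {v : E | (K : ℝ) ≤ ‖v‖}) := fun i j hij v hv => by
      simp only [Set.mem_ofPred_eq] at hv ⊢
      exact le_trans (Nat.cast_le.2 hij) hv
    have hempty : ⋂ K : ℕ, {v : E | (K : ℝ) ≤ ‖v‖} = ∅ := by
      ext v
      obtain ⟨n, hn⟩ := exists_nat_gt ‖v‖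
      simp only [Set.mem_iInter, Set.mem_ofPred_eq, Set.mem_empty_iff_false, iff_false, not_forall]
      exact ⟨n, not_le.2 hn⟩
    have := tendsto_measure_iInter_atTop (μ := P'.map W)
      (fun K : ℕ => (hclosed K).measurableSet.nullMeasurableSet) hanti
      ⟨0, by
        have := Measure.isProbabilityMeasure_map (μ := P') h.aemeasurable_limit
        exact measure_ne_top _ _⟩
    rw [hempty, measure_empty] at this
    exact this
  obtain ⟨K, hK0, hK⟩ := ((eventually_gt_atTop 0).and (hlim.eventually_lt_const hδ)).exists
  refine ⟨K, by exact_mod_cast hK0, ?_⟩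
  have hls := ProbabilityMeasure.limsup_measure_closed_le_of_tendsto h.tendsto (hclosed K)
  filter_upwards [eventually_lt_of_limsup_lt (hls.trans_lt hK)] with r hr
  simpa [Measure.map_apply_of_aemeasurable (h.forall_aemeasurable r) (hclosed K).measurableSet]
    using hr

/-- The delta method for a directionally differentiable functional `F` with a continuous
derivative `D`. The derivative need not be linear; positive homogeneity suffices. -/
lemma tendstoInDistribution_delta_method {Ω Ω' E : Type*} [MeasurableSpace Ω]
    {P : Measure Ω} [IsProbabilityMeasure P] [MeasurableSpace Ω'] {P' : Measure Ω'}
    [IsProbabilityMeasure P'] [NormedAddCommGroup E] [NormedSpace ℝ E] [MeasurableSpace E]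
    [BorelSpace E] {F D : E → ℝ} (hD : Continuous D)
    (hDhom : ∀ (c : ℝ) (v : E), 0 ≤ c → D (c • v) = c * D v)
    (hF : (fun v => F v - F 0 - D v) =o[𝓝 0] (fun v => v))
    {τ : ℕ → ℝ} (hτ : Tendsto τ atTop atTop) {θ : ℕ → Ω → E} {W : Ω' → E}
    (hθ : TendstoInDistribution (fun r ω => τ r • θ r ω) atTop W (fun _ => P) P')
    (hmeas : ∀ r, AEMeasurable (fun ω => τ r * (F (θ r ω) - F 0)) P) :
    TendstoInDistribution (fun r ω => τ r * (F (θ r ω) - F 0)) atTop (fun ω => D (W ω))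
      (fun _ => P) P' := by
  refine tendstoInDistribution_of_tendstoInMeasure_sub _ _ (hθ.continuous_comp hD) ?_ hmeas
  rw [tendstoInMeasure_iff_norm]
  intro ε hε
  refine ENNReal.tendsto_nhds_zero.2 fun δ hδ => ?_
  obtain ⟨K, hK, hKr⟩ := exists_eventually_measure_norm_ge_lt hθ hδ
  -- Where `‖τ θ‖ < K`, the remainder is at most `τ (ε / (2K)) ‖θ‖ ≤ ε / 2`.
  obtain ⟨ρ, hρ, hball⟩ := Metric.eventually_nhds_iff.1
    (Asymptotics.isLittleO_iff.1 hF (show 0 < ε / (2 * K) by positivity))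
  filter_upwards [hKr, hτ.eventually_gt_atTop 0, hτ.eventually_gt_atTop (K / ρ)] with r hr h0 h1
  refine (measure_mono fun ω hω => ?_).trans hr.le
  by_contra hlt
  simp only [Set.mem_ofPred_eq, not_le, norm_smul, Real.norm_eq_abs, abs_of_pos h0] at hlt
  have hsmall : ‖θ r ω‖ < ρ := by
    rw [div_lt_iff₀ hρ] at h1
    exact lt_of_mul_lt_mul_left (hlt.trans h1) h0.le
  have hR := hball (y := θ r ω) (by simpa using hsmall)
  have key : ‖((fun r ω => τ r * (F (θ r ω) - F 0)) - fun r => D ∘ fun ω => τ r • θ r ω) r ω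
      - (0 : ℕ → Ω → ℝ) r ω‖ = τ r * ‖F (θ r ω) - F 0 - D (θ r ω)‖ := by
    simp only [Pi.sub_apply, Function.comp_apply, hDhom _ _ h0.le, Pi.zero_apply, sub_zero,
      ← mul_sub, norm_mul, Real.norm_eq_abs, abs_of_pos h0]
  have hω' : ε ≤ τ r * ‖F (θ r ω) - F 0 - D (θ r ω)‖ := by
    rw [← key]; exact hω
  have : τ r * ‖F (θ r ω) - F 0 - D (θ r ω)‖ ≤ ε / (2 * K) * (τ r * ‖θ r ω‖) := by
    calc _ ≤ τ r * (ε / (2 * K) * ‖θ r ω‖) := mul_le_mul_of_nonneg_left hR h0.le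
      _ = _ := by ring
  have h3 : ε / (2 * K) * (τ r * ‖θ r ω‖) ≤ ε / (2 * K) * K :=
    mul_le_mul_of_nonneg_left hlt.le (by positivity)
  have h4 : ε / (2 * K) * K = ε / 2 := by field_simp
  linarith

/-! ### A central limit theorem for blocks of independent variables -/

section

variable {Ω : Type*} [MeasurableSpace Ω] {P : Measure Ω} [IsProbabilityMeasure P]

/-- The characteristic function of a rescaled partial sum of centred i.i.d. variables, along
numbers of summands `M r → ∞` and scales `c r` with `√(M r) c r → s`. -/
lemma tendsto_charFun_rescaled_sum {ξ : ℕ → Ω → ℝ} (hindep : iIndepFun ξ P)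
    (hident : ∀ j, IdentDistrib (ξ j) (ξ 0) P P) (hLp : MemLp (ξ 0) 2 P)
    (hmean : ∫ ω, ξ 0 ω ∂P = 0) {M : ℕ → ℕ} (hM : Tendsto M atTop atTop) {c : ℕ → ℝ} {s : ℝ}
    (hc : Tendsto (fun r => √(M r : ℝ) * c r) atTop (𝓝 s)) (t : ℝ) :
    Tendsto (fun r => charFun (P.map fun ω => c r * ∑ j ∈ Finset.range (M r), ξ j ω) t) atTop
      (𝓝 (Complex.exp (-((s ^ 2 * variance (ξ 0) P * t ^ 2 / 2 : ℝ) : ℂ)))) := by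
  set v := variance (ξ 0) P with hv
  have hclt := tendstoInDistribution_inv_sqrt_mul_sum_sub (P := P)
    (P' := gaussianReal 0 v.toNNReal) (Y := id) ⟨by fun_prop, by simp [hv]⟩ hLp hindep hident
  simp only [hmean, mul_zero, sub_zero] at hclt
  have hsub : TendstoInDistribution
      (fun r ω => (√(M r : ℝ))⁻¹ * ∑ j ∈ Finset.range (M r), ξ j ω) atTop id (fun _ => P)
      (gaussianReal 0 v.toNNReal) :=
    ⟨fun r => hclt.forall_aemeasurable (M r), hclt.aemeasurable_limit, hclt.tendsto.comp hM⟩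
  have hconst : TendstoInMeasure P (fun r (_ : Ω) => √(M r : ℝ) * c r) atTop (fun _ => s) :=
    tendstoInMeasure_of_tendsto_ae (fun _ => aestronglyMeasurable_const) (.of_forall fun _ => hc)
  have hprod := hsub.continuous_comp_prodMk_of_tendstoInMeasure_const
    (g := fun q : ℝ × ℝ => q.2 * q.1) (by fun_prop) hconst (fun _ => aemeasurable_const)
  have hfun := ProbabilityMeasure.tendsto_iff_tendsto_charFun.1 hprod.tendsto t
  simp only [ProbabilityMeasure.coe_mk] at hfun
  have hlim : charFun ((gaussianReal 0 v.toNNReal).map fun ω => s * id ω) t =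
      Complex.exp (-((s ^ 2 * v * t ^ 2 / 2 : ℝ) : ℂ)) := by
    rw [show (fun ω : ℝ => s * id ω) = (s * ·) from rfl, charFun_map_mul, charFun_gaussianReal]
    simp only [Complex.ofReal_zero, mul_zero, zero_mul, zero_sub, Complex.ofReal_mul,
      Real.coe_toNNReal _ (variance_nonneg _ _), hv]
    push_cast
    congr 1
    ring
  rw [hlim] at hfun
  refine hfun.congr fun r => ?_
  congr 2
  ext ω
  -- For `M r = 0` the sum is empty, and the junk value of `(√0)⁻¹` does not matter.
  rcases Nat.eq_zero_or_pos (M r) with h | h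
  · simp [h]
  · have : √(M r : ℝ) ≠ 0 := by positivity
    field_simp

/-- The characteristic function of a linear combination of partial sums, over finitely many
blocks that are jointly independent, of centred i.i.d. variables. -/
lemma tendsto_charFun_sum_blocks {J : Type*} [Fintype J] {ξ : J → ℕ → Ω → ℝ}
    (hindep : iIndepFun (fun s : (_ : J) × ℕ => ξ s.1 s.2) P)
    (hident : ∀ a j, IdentDistrib (ξ a j) (ξ a 0) P P) (hLp : ∀ a, MemLp (ξ a 0) 2 P)
    (hmean : ∀ a, ∫ ω, ξ a 0 ω ∂P = 0) {M : ℕ → J → ℕ}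
    (hM : ∀ a, Tendsto (fun r => M r a) atTop atTop) {c : ℕ → J → ℝ} {s : J → ℝ}
    (hc : ∀ a, Tendsto (fun r => √(M r a : ℝ) * c r a) atTop (𝓝 (s a))) :
    Tendsto
      (fun r => charFun
        (P.map fun ω => ∑ a, c r a * ∑ j ∈ Finset.range (M r a), ξ a j ω) 1) atTop
      (𝓝 (Complex.exp (-((∑ a, s a ^ 2 * variance (ξ a 0) P) / 2 : ℝ)))) := by
  have hmeas : ∀ a j, AEMeasurable (ξ a j) P := fun a j => (hident a j).aemeasurable_fst
  have hblock : ∀ a, iIndepFun (ξ a) P := fun a =>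
    hindep.precomp (g := fun j : ℕ => (⟨a, j⟩ : (_ : J) × ℕ))
      (fun i j h => by simpa using h)
  have hprod : ∀ r, charFun
      (P.map fun ω => ∑ a, c r a * ∑ j ∈ Finset.range (M r a), ξ a j ω) 1 =
      ∏ a, charFun (P.map fun ω => c r a * ∑ j ∈ Finset.range (M r a), ξ a j ω) 1 := by
    intro r
    have hind : iIndepFun (fun (s : (_ : J) × ℕ) ω => c r s.1 * ξ s.1 s.2 ω) P :=
      hindep.comp (fun s y => c r s.1 * y) (fun s => by fun_prop)
    have h1 := (hind.restrict
      (Finset.univ.sigma fun a : J => Finset.range (M r a) :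
        Finset ((_ : J) × ℕ))).charFun_map_fun_finsetSum_eq_prod
      (fun s _ => (hmeas s.1 s.2).const_mul (c r s.1))
    simp only [Finset.sum_sigma, Finset.prod_sigma] at h1
    simp only [Finset.mul_sum]
    rw [h1, Finset.prod_apply]
    refine Finset.prod_congr rfl fun a _ => ?_
    have hinda : iIndepFun (fun (j : ℕ) ω => c r a * ξ a j ω) P :=
      (hblock a).comp (fun _ y => c r a * y) (fun _ => by fun_prop)
    rw [(hinda.restrict (Finset.range (M r a))).charFun_map_fun_finsetSum_eq_prod
      (fun j _ => (hmeas a j).const_mul (c r a))]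
  simp_rw [hprod]
  have hexp : Complex.exp (-((∑ a, s a ^ 2 * variance (ξ a 0) P) / 2 : ℝ)) =
      ∏ a, Complex.exp (-((s a ^ 2 * variance (ξ a 0) P * 1 ^ 2 / 2 : ℝ) : ℂ)) := by
    rw [← Complex.exp_sum]
    congr 1
    push_cast
    rw [Finset.sum_neg_distrib, Finset.sum_div]
    simp
  rw [hexp]
  exact tendsto_finsetProd _ fun a _ =>
    tendsto_charFun_rescaled_sum (hblock a) (hident a) (hLp a) (hmean a) (hM a) (hc a) 1

end

/-! ### The area between two regression curves as a function of the parameters -/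

lemma inner_gradient_eq_fderiv {p : ℕ} (f : Vec p → ℝ) (b v : Vec p) :
    inner ℝ (gradient f b) v = fderiv ℝ f b v := by
  rw [gradient, InnerProductSpace.toDual_symm_apply]

namespace IsRegularRegression

variable {d p : ℕ} {X : Set (Vec d)} {B : Set (Vec p)} {β : Vec p} {m : Vec d → Vec p → ℝ}

lemma hasFDerivAt (hm : IsRegularRegression X B β m) {x : Vec d} (hx : x ∈ X) :
    HasFDerivAt (m x) (fderiv ℝ (m x) β) β := by
  obtain ⟨U, hU, hβU, hC, -⟩ := hm.smooth_near
  exact (((hC x hx).contDiffAt (hU.mem_nhds hβU)).differentiableAt (by norm_num)).hasFDerivAt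

lemma continuousOn_fderiv (hm : IsRegularRegression X B β m) :
    ContinuousOn (fun x => fderiv ℝ (m x) β) X := by
  obtain ⟨U, -, hβU, -, -, hD, -⟩ := hm.smooth_near
  exact hD.comp (f := fun x : Vec d => (x, β)) (by fun_prop) fun x hx => ⟨hx, hβU⟩

lemma exists_norm_fderiv_le (hX : IsCompact X) (hm : IsRegularRegression X B β m) :
    ∃ C, ∀ x ∈ X, ‖fderiv ℝ (m x) β‖ ≤ C :=
  hX.exists_bound_of_continuousOn hm.continuousOn_fderiv

lemma eventually_continuousOn (hm : IsRegularRegression X B β m) :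
    ∀ᶠ b in 𝓝 β, ContinuousOn (fun x => m x b) X := by
  obtain ⟨U, hU, hβU, -, hc, -⟩ := hm.smooth_near
  filter_upwards [hU.mem_nhds hβU] with b hb
  exact hc.comp (f := fun x : Vec d => (x, b)) (by fun_prop) fun x hx => ⟨hx, hb⟩

/-- Near the true parameter, the regression curves are Lipschitz in the parameter, uniformly in
the covariate: the derivative is bounded on the product of `X` and a small closed ball. -/
lemma exists_eventually_abs_sub_le (hX : IsCompact X) (hm : IsRegularRegression X B β m) :
    ∃ C, ∀ᶠ b in 𝓝 β, ∀ x ∈ X, |m x b - m x β| ≤ C * ‖b - β‖ := by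
  obtain ⟨U, hU, hβU, hC, -, hD, -⟩ := hm.smooth_near
  obtain ⟨ρ, hρ, hball⟩ := Metric.nhds_basis_closedBall.mem_iff.1 (hU.mem_nhds hβU)
  obtain ⟨C, hCb⟩ := (hX.prod (isCompact_closedBall β ρ)).exists_bound_of_continuousOn
    (hD.mono (Set.prod_mono subset_rfl hball))
  refine ⟨C, ?_⟩
  filter_upwards [Metric.closedBall_mem_nhds β hρ] with b hb x hx
  refine (convex_closedBall β ρ).norm_image_sub_le_of_norm_fderiv_le (f := m x)
    (fun y hy => ?_) (fun y hy => hCb (x, y) ⟨hx, hy⟩) (Metric.mem_closedBall_self hρ.le) hb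
  exact ((hC x hx).contDiffAt (hU.mem_nhds (hball hy))).differentiableAt (by norm_num)

end IsRegularRegression

section

variable {d : ℕ} {X : Set (Vec d)} {p : Fin 2 → ℕ} {m : (ℓ : Fin 2) → Vec d → Vec (p ℓ) → ℝ}
  {B : (ℓ : Fin 2) → Set (Vec (p ℓ))} {β : (ℓ : Fin 2) → Vec (p ℓ)}

/-- The derivative, in the pair of parameters at `β`, of the difference
`m 0 x (b 0) - m 1 x (b 1)` of the two curves at the point `x`. The pair of parameters is an
element of the `ℓ²` direct sum, which is a Euclidean space. -/
noncomputable def curveDifferential (m : (ℓ : Fin 2) → Vec d → Vec (p ℓ) → ℝ)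
    (β : (ℓ : Fin 2) → Vec (p ℓ)) (x : Vec d) : PiLp 2 (fun ℓ => Vec (p ℓ)) →L[ℝ] ℝ :=
  (fderiv ℝ (m 0 x) (β 0)).comp (PiLp.proj 2 (fun ℓ => Vec (p ℓ)) 0) -
    (fderiv ℝ (m 1 x) (β 1)).comp (PiLp.proj 2 (fun ℓ => Vec (p ℓ)) 1)

lemma curveDifferential_apply (x : Vec d) (v : PiLp 2 (fun ℓ => Vec (p ℓ))) :
    curveDifferential m β x v =
      fderiv ℝ (m 0 x) (β 0) (v 0) - fderiv ℝ (m 1 x) (β 1) (v 1) := rfl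

lemma hasFDerivAt_curveDifference (hm : ∀ ℓ, IsRegularRegression X (B ℓ) (β ℓ) (m ℓ)) {x : Vec d}
    (hx : x ∈ X) :
    HasFDerivAt (fun v : PiLp 2 (fun ℓ => Vec (p ℓ)) => m 0 x (β 0 + v 0) - m 1 x (β 1 + v 1))
      (curveDifferential m β x) 0 := by
  have h : ∀ ℓ, HasFDerivAt (fun v : PiLp 2 (fun ℓ => Vec (p ℓ)) => m ℓ x (β ℓ + v ℓ))
      ((fderiv ℝ (m ℓ x) (β ℓ)).comp (PiLp.proj 2 (fun ℓ => Vec (p ℓ)) ℓ)) 0 := fun ℓ => by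
    have h1 : HasFDerivAt (fun v : PiLp 2 (fun ℓ => Vec (p ℓ)) => β ℓ + v ℓ)
        (PiLp.proj 2 (fun ℓ => Vec (p ℓ)) ℓ : PiLp 2 (fun ℓ => Vec (p ℓ)) →L[ℝ] Vec (p ℓ)) 0 :=
      (PiLp.proj 2 (fun ℓ => Vec (p ℓ)) ℓ).hasFDerivAt.const_add (β ℓ)
    refine HasFDerivAt.comp (g := m ℓ x) 0 ?_ h1
    simpa using (hm ℓ).hasFDerivAt hx
  exact (h 0).sub (h 1)

lemma continuousOn_curveDifferential (hm : ∀ ℓ, IsRegularRegression X (B ℓ) (β ℓ) (m ℓ))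
    (v : PiLp 2 (fun ℓ => Vec (p ℓ))) :
    ContinuousOn (fun x => curveDifferential m β x v) X := by
  simp only [curveDifferential_apply]
  exact ((hm 0).continuousOn_fderiv.clm_apply continuousOn_const).sub
    ((hm 1).continuousOn_fderiv.clm_apply continuousOn_const)

lemma exists_norm_curveDifferential_le (hX : IsCompact X)
    (hm : ∀ ℓ, IsRegularRegression X (B ℓ) (β ℓ) (m ℓ)) :
    ∃ C, ∀ x ∈ X, ‖curveDifferential m β x‖ ≤ C := by
  choose C hC using fun ℓ => (hm ℓ).exists_norm_fderiv_le hX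
  refine ⟨C 0 + C 1, fun x hx => ?_⟩
  have h0 : ∀ ℓ, 0 ≤ C ℓ := fun ℓ => (norm_nonneg _).trans (hC ℓ x hx)
  refine ContinuousLinearMap.opNorm_le_bound _ (add_nonneg (h0 0) (h0 1)) fun v => ?_
  have h : ∀ ℓ, ‖fderiv ℝ (m ℓ x) (β ℓ) (v ℓ)‖ ≤ C ℓ * ‖v‖ := fun ℓ =>
    (ContinuousLinearMap.le_of_opNorm_le _ (hC ℓ x hx) _).trans
      (mul_le_mul_of_nonneg_left (PiLp.norm_apply_le v ℓ) (h0 ℓ))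
  rw [curveDifferential_apply, add_mul]
  exact (norm_sub_le _ _).trans (add_le_add (h 0) (h 1))

lemma continuousOn_curveDifference (hm : ∀ ℓ, IsRegularRegression X (B ℓ) (β ℓ) (m ℓ)) :
    ContinuousOn (fun x => m 0 x (β 0) - m 1 x (β 1)) X :=
  (hm 0).eventually_continuousOn.self_of_nhds.sub (hm 1).eventually_continuousOn.self_of_nhds

/-- The directional derivative of the area between the curves, as a single integral. -/
lemma directionalArea_curveDifferential (hX : IsCompact X)
    (hm : ∀ ℓ, IsRegularRegression X (B ℓ) (β ℓ) (m ℓ)) (v : PiLp 2 (fun ℓ => Vec (p ℓ))) :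
    directionalArea X (m 0) (m 1) (β 0) (β 1) (fun x => curveDifferential m β x v) =
      ∫ x in X, absDeriv (m 0 x (β 0) - m 1 x (β 1)) (curveDifferential m β x v) := by
  have hcont := continuousOn_curveDifference hm
  have hN : MeasurableSet (coincidenceSet X (m 0) (m 1) (β 0) (β 1)) := by
    have : coincidenceSet X (m 0) (m 1) (β 0) (β 1) =
        X ∩ (fun x => m 0 x (β 0) - m 1 x (β 1)) ⁻¹' {0} := rfl
    rw [this]
    exact (hcont.preimage_isClosed_of_isClosed hX.isClosed isClosed_singleton).measurableSet
  have hsub : coincidenceSet X (m 0) (m 1) (β 0) (β 1) ⊆ X := fun x hx => hx.1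
  obtain ⟨C, hC⟩ := exists_norm_curveDifferential_le hX hm
  have hmeas : AEStronglyMeasurable (fun x => absDeriv (m 0 x (β 0) - m 1 x (β 1))
      (curveDifferential m β x v)) (volume.restrict X) :=
    aestronglyMeasurable_absDeriv (hcont.aestronglyMeasurable hX.measurableSet)
      ((continuousOn_curveDifferential hm v).aestronglyMeasurable hX.measurableSet)
  have hint : IntegrableOn (fun x => absDeriv (m 0 x (β 0) - m 1 x (β 1))
      (curveDifferential m β x v)) X := by
    refine IntegrableOn.of_bound hX.measure_lt_top hmeas (C * ‖v‖) ?_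
    filter_upwards [ae_restrict_mem hX.measurableSet] with x hx
    exact (abs_absDeriv_le _ _).trans (ContinuousLinearMap.le_of_opNorm_le _ (hC x hx) v)
  rw [directionalArea, ← sub_add_cancel (∫ x in X, _) (∫ x in coincidenceSet X (m 0) (m 1) (β 0)
    (β 1), absDeriv (m 0 x (β 0) - m 1 x (β 1)) (curveDifferential m β x v)),
    ← setIntegral_sdiff hN hint hsub]
  congr 1
  · refine setIntegral_congr_fun (hX.measurableSet.diff hN) fun x hx => ?_
    have : m 0 x (β 0) - m 1 x (β 1) ≠ 0 := fun h => hx.2 ⟨hx.1, h⟩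
    simp [absDeriv, this]
  · refine setIntegral_congr_fun hN fun x hx => ?_
    have : m 0 x (β 0) - m 1 x (β 1) = 0 := hx.2
    simp [absDeriv, this]

lemma continuous_directionalArea_curveDifferential (hX : IsCompact X)
    (hm : ∀ ℓ, IsRegularRegression X (B ℓ) (β ℓ) (m ℓ)) :
    Continuous fun v : PiLp 2 (fun ℓ => Vec (p ℓ)) =>
      directionalArea X (m 0) (m 1) (β 0) (β 1) (fun x => curveDifferential m β x v) := by
  simp_rw [directionalArea_curveDifferential hX hm]
  have : Fact (volume X < ∞) := ⟨hX.measure_lt_top⟩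
  obtain ⟨C, hC⟩ := exists_norm_curveDifferential_le hX hm
  exact continuous_integral_absDeriv
    ((continuousOn_curveDifference hm).aestronglyMeasurable hX.measurableSet)
    (fun v => (continuousOn_curveDifferential hm v).aestronglyMeasurable hX.measurableSet)
    (by filter_upwards [ae_restrict_mem hX.measurableSet] with x hx using hC x hx)

lemma directionalArea_curveDifferential_smul (hX : IsCompact X)
    (hm : ∀ ℓ, IsRegularRegression X (B ℓ) (β ℓ) (m ℓ)) (c : ℝ)
    (v : PiLp 2 (fun ℓ => Vec (p ℓ))) (hc : 0 ≤ c) :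
    directionalArea X (m 0) (m 1) (β 0) (β 1) (fun x => curveDifferential m β x (c • v)) =
      c * directionalArea X (m 0) (m 1) (β 0) (β 1) (fun x => curveDifferential m β x v) := by
  simp_rw [directionalArea_curveDifferential hX hm, map_smul, smul_eq_mul,
    absDeriv_mul_of_nonneg _ _ hc, integral_const_mul]

/-- The area between the curves is directionally differentiable in the parameters. -/
lemma isLittleO_areaBetween (hX : IsCompact X)
    (hm : ∀ ℓ, IsRegularRegression X (B ℓ) (β ℓ) (m ℓ)) :
    (fun v : PiLp 2 (fun ℓ => Vec (p ℓ)) =>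
      areaBetween X (m 0) (m 1) (β 0 + v 0) (β 1 + v 1) -
        areaBetween X (m 0) (m 1) (β 0 + (0 : PiLp 2 (fun ℓ => Vec (p ℓ))) 0)
          (β 1 + (0 : PiLp 2 (fun ℓ => Vec (p ℓ))) 1) -
        directionalArea X (m 0) (m 1) (β 0) (β 1) (fun x => curveDifferential m β x v))
      =o[𝓝 0] (fun v => v) := by
  have : Fact (volume X < ∞) := ⟨hX.measure_lt_top⟩
  have htend : ∀ ℓ, Tendsto (fun v : PiLp 2 (fun ℓ => Vec (p ℓ)) => β ℓ + v ℓ) (𝓝 0)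
      (𝓝 (β ℓ)) := fun ℓ => by
    have h : Continuous (fun v : PiLp 2 (fun ℓ => Vec (p ℓ)) => β ℓ + v ℓ) := by fun_prop
    simpa using h.tendsto 0
  have hcont : ∀ᶠ v : PiLp 2 (fun ℓ => Vec (p ℓ)) in 𝓝 0,
      ContinuousOn (fun x => m 0 x (β 0 + v 0) - m 1 x (β 1 + v 1)) X := by
    filter_upwards [(htend 0).eventually (hm 0).eventually_continuousOn,
      (htend 1).eventually (hm 1).eventually_continuousOn] with v h0 h1 using h0.sub h1
  obtain ⟨C₀, hC₀⟩ := (hm 0).exists_eventually_abs_sub_le hX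
  obtain ⟨C₁, hC₁⟩ := (hm 1).exists_eventually_abs_sub_le hX
  obtain ⟨C₂, hC₂⟩ := exists_norm_curveDifferential_le hX hm
  have key := isLittleO_integral_abs (μ := volume.restrict X)
    (f := fun (v : PiLp 2 (fun ℓ => Vec (p ℓ))) x => m 0 x (β 0 + v 0) - m 1 x (β 1 + v 1))
    (L := curveDifferential m β) (C := max (|C₀| + |C₁|) C₂)
    (hcont.mono fun v hv => hv.aestronglyMeasurable hX.measurableSet)
    (hcont.self_of_nhds.integrableOn_compact hX)
    (fun v => (continuousOn_curveDifferential hm v).aestronglyMeasurable hX.measurableSet)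
    (by
      filter_upwards [ae_restrict_mem hX.measurableSet] with x hx
      exact (hC₂ x hx).trans (le_max_right _ _))
    (by
      filter_upwards [ae_restrict_mem hX.measurableSet] with x hx
      exact hasFDerivAt_curveDifference hm hx)
    (by
      filter_upwards [(htend 0).eventually hC₀, (htend 1).eventually hC₁] with v h0 h1
      filter_upwards [ae_restrict_mem hX.measurableSet] with x hx
      have h0' := h0 x hx
      have h1' := h1 x hx
      simp only [add_sub_cancel_left] at h0' h1'
      have hn : ∀ (c : ℝ) (ℓ : Fin 2), c * ‖v ℓ‖ ≤ |c| * ‖v‖ := fun c ℓ =>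
        mul_le_mul (le_abs_self c) (PiLp.norm_apply_le v ℓ) (norm_nonneg _) (abs_nonneg _)
      calc _ = |(m 0 x (β 0 + v 0) - m 0 x (β 0)) - (m 1 x (β 1 + v 1) - m 1 x (β 1))| := by
            simp only [PiLp.zero_apply, add_zero]
            congr 1
            ring
        _ ≤ |C₀| * ‖v‖ + |C₁| * ‖v‖ :=
            (abs_sub _ _).trans (add_le_add (h0'.trans (hn _ _)) (h1'.trans (hn _ _)))
        _ ≤ _ := by
            rw [← add_mul]
            exact mul_le_mul_of_nonneg_right (le_max_left _ _) (norm_nonneg _))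
  simp only [directionalArea_curveDifferential hX hm]
  simpa only [areaBetween, PiLp.zero_apply, add_zero] using key

/-- On the compact parameter sets the area between the curves is continuous in the parameters. -/
lemma continuousOn_areaBetween (hX : IsCompact X) (hB : ∀ ℓ, IsCompact (B ℓ))
    (hm : ∀ ℓ, IsRegularRegression X (B ℓ) (β ℓ) (m ℓ)) :
    ContinuousOn (fun b : Vec (p 0) × Vec (p 1) => areaBetween X (m 0) (m 1) b.1 b.2)
      (B 0 ×ˢ B 1) := by
  have : Fact (volume X < ∞) := ⟨hX.measure_lt_top⟩
  choose C hC using fun ℓ => (hX.prod (hB ℓ)).exists_bound_of_continuousOn (hm ℓ).continuousOn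
  have hx : ∀ ℓ, ∀ b ∈ B ℓ, ContinuousOn (fun x => m ℓ x b) X := fun ℓ b hb =>
    (hm ℓ).continuousOn.comp (f := fun x : Vec d => (x, b)) (by fun_prop) fun x hx => ⟨hx, hb⟩
  have hb : ∀ ℓ, ∀ x ∈ X, ContinuousOn (m ℓ x) (B ℓ) := fun ℓ x hx =>
    (hm ℓ).continuousOn.comp (f := fun b : Vec (p ℓ) => (x, b)) (by fun_prop)
      fun b hb => ⟨hx, hb⟩
  refine continuousOn_of_dominated (bound := fun _ => C 0 + C 1) (fun b hb => ?_)
    (fun b hb => ?_) (integrable_const _) ?_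
  · exact ((hx 0 b.1 hb.1).sub (hx 1 b.2 hb.2)).abs.aestronglyMeasurable hX.measurableSet
  · filter_upwards [ae_restrict_mem hX.measurableSet] with x hx
    rw [Real.norm_eq_abs, abs_abs]
    exact (abs_sub _ _).trans (add_le_add (hC 0 (x, b.1) ⟨hx, hb.1⟩) (hC 1 (x, b.2) ⟨hx, hb.2⟩))
  · filter_upwards [ae_restrict_mem hX.measurableSet] with x hx
    exact (((hb 0 x hx).comp continuousOn_fst fun b hb => hb.1).sub
      ((hb 1 x hx).comp continuousOn_snd fun b hb => hb.2)).abs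

lemma measurable_areaBetween_comp {Ω : Type*} [MeasurableSpace Ω] (hX : IsCompact X)
    (hB : ∀ ℓ, IsCompact (B ℓ)) (hm : ∀ ℓ, IsRegularRegression X (B ℓ) (β ℓ) (m ℓ))
    {b : (ℓ : Fin 2) → Ω → Vec (p ℓ)} (hb : ∀ ℓ, Measurable (b ℓ)) (hbB : ∀ ℓ ω, b ℓ ω ∈ B ℓ) :
    Measurable fun ω => areaBetween X (m 0) (m 1) (b 0 ω) (b 1 ω) := by
  have hrestr := (continuousOn_iff_continuous_domRestrict.1
    (continuousOn_areaBetween hX hB hm)).measurable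
  exact hrestr.comp (((hb 0).prodMk (hb 1)).subtype_mk (h := fun ω => ⟨hbB 0 ω, hbB 1 ω⟩))

end

/-! ### Covariance matrices -/

lemma posSemidef_informationMatrix {d p k : ℕ} (m : Vec d → Vec p → ℝ) (x : Fin k → Vec d)
    {ζ : Fin k → ℝ} (hζ : ∀ i, 0 ≤ ζ i) (σ : ℝ) (β : Vec p) :
    (informationMatrix m x ζ σ β).PosSemidef := by
  refine Matrix.PosSemidef.smul ?_ (by positivity)
  refine Matrix.posSemidef_sum _ fun i _ => Matrix.PosSemidef.smul ?_ (hζ i)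
  simpa using Matrix.posSemidef_vecMulVec_self_star (gradient (m (x i)) β).ofLp

lemma invSqrtApply_eq_toEuclideanCLM {p : ℕ} (S : Matrix (Fin p) (Fin p) ℝ) (z : Vec p) :
    invSqrtApply S z = Matrix.toEuclideanCLM (𝕜 := ℝ) (CFC.sqrt S⁻¹) z := rfl

lemma inner_invSqrtApply_left {p : ℕ} (S : Matrix (Fin p) (Fin p) ℝ) (z t : Vec p) :
    inner ℝ (invSqrtApply S z) t = inner ℝ z (invSqrtApply S t) := by
  have h : IsSelfAdjoint (Matrix.toEuclideanCLM (𝕜 := ℝ) (CFC.sqrt S⁻¹)) :=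
    (CFC.sqrt_nonneg S⁻¹).isSelfAdjoint.map _
  rw [invSqrtApply_eq_toEuclideanCLM, invSqrtApply_eq_toEuclideanCLM,
    ← ContinuousLinearMap.adjoint_inner_right, h.adjoint_eq]

lemma norm_invSqrtApply_sq {p : ℕ} {S : Matrix (Fin p) (Fin p) ℝ} (hS : S.PosSemidef)
    (t : Vec p) :
    ‖invSqrtApply S t‖ ^ 2 = t.ofLp ⬝ᵥ S⁻¹.mulVec t.ofLp := by
  rw [← real_inner_self_eq_norm_sq, inner_invSqrtApply_left, invSqrtApply_eq_toEuclideanCLM,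
    invSqrtApply_eq_toEuclideanCLM, ← mul_apply_eq_comp, ← map_mul,
    CFC.sqrt_mul_sqrt_self _ hS.inv.nonneg, Matrix.inner_toEuclideanCLM]

section

variable {Ω : Type*} [MeasurableSpace Ω] {P : Measure Ω} [IsProbabilityMeasure P]

/-- The variance of a linear form of a centred random vector, by its second moments. -/
lemma variance_inner_eq_sum {p : ℕ} {ψ : Ω → Vec p} (hLp : MemLp ψ 2 P)
    (hmean : ∫ ω, ψ ω ∂P = 0) (t : Vec p) :
    variance (fun ω => inner ℝ (ψ ω) t) P =
      t.ofLp ⬝ᵥ (Matrix.of fun a b => ∫ ω, ψ ω a * ψ ω b ∂P).mulVec t.ofLp := by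
  have hcoord : ∀ a, MemLp (fun ω => ψ ω a) 2 P := fun a => by
    have := (EuclideanSpace.proj a : Vec p →L[ℝ] ℝ).comp_memLp' hLp
    exact this
  have hint : ∀ a b, Integrable (fun ω => ψ ω a * ψ ω b) P := fun a b =>
    (hcoord a).integrable_mul (hcoord b)
  have hmean' : ∫ ω, inner ℝ (ψ ω) t ∂P = 0 := by
    simp_rw [real_inner_comm t]
    rw [integral_inner (hLp.integrable (by norm_num)), hmean, inner_zero_right]
  rw [variance_of_integral_eq_zero (hLp.inner_const t).aestronglyMeasurable.aemeasurable hmean']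
  have hsq : ∀ ω, (inner ℝ (ψ ω) t) ^ 2 = ∑ a, ∑ b, t a * t b * (ψ ω a * ψ ω b) := fun ω => by
    rw [PiLp.inner_apply, sq, Finset.sum_mul_sum]
    refine Finset.sum_congr rfl fun a _ => Finset.sum_congr rfl fun b _ => ?_
    simp only [RCLike.inner_apply, conj_trivial]
    ring
  simp_rw [hsq]
  rw [integral_finsetSum _ fun a _ => integrable_finsetSum _ fun b _ => (hint a b).const_mul _]
  simp only [dotProduct, Matrix.mulVec, Finset.mul_sum, Matrix.of_apply]
  refine Finset.sum_congr rfl fun a _ => ?_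
  rw [integral_finsetSum _ fun b _ => (hint a b).const_mul _]
  refine Finset.sum_congr rfl fun b _ => ?_
  rw [integral_const_mul]
  ring

end

/-- Reduction of a characteristic function to that of a linear form. -/
lemma charFun_map_eq_charFun_map_inner {Ω : Type*} [MeasurableSpace Ω]
    {P : Measure Ω} {E : Type*} [NormedAddCommGroup E] [InnerProductSpace ℝ E] [MeasurableSpace E]
    [BorelSpace E] {W : Ω → E} (hW : AEMeasurable W P) (t : E) :
    charFun (P.map W) t = charFun (P.map fun ω => inner ℝ (W ω) t) 1 := by
  have h : Measurable fun w : E => inner ℝ w t := (continuous_id.inner continuous_const).measurable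
  have hWt : AEMeasurable (fun ω => inner ℝ (W ω) t) P := h.comp_aemeasurable hW
  rw [charFun_apply, charFun_apply_real, integral_map hW, integral_map hWt]
  · simp
  · exact Continuous.aestronglyMeasurable (by fun_prop)
  · exact Continuous.aestronglyMeasurable (by fun_prop)

/-! ### Joint asymptotic normality of the two groups -/

section

variable {Ω : Type*} [MeasurableSpace Ω] {P : Measure Ω} [IsProbabilityMeasure P]
  {Ω' : Type*} [MeasurableSpace Ω'] {P' : Measure Ω'}
  {p k : Fin 2 → ℕ}

lemma measurable_invSqrtApply {p : ℕ} (S : Matrix (Fin p) (Fin p) ℝ) :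
    Measurable (invSqrtApply S) :=
  (Matrix.toEuclideanCLM (𝕜 := ℝ) (CFC.sqrt S⁻¹)).continuous.measurable

lemma charFun_map_toLp_smul_invSqrtApply {S : (ℓ : Fin 2) → Matrix (Fin (p ℓ)) (Fin (p ℓ)) ℝ}
    (hS : ∀ ℓ, (S ℓ).PosSemidef) {Z : (ℓ : Fin 2) → Ω' → Vec (p ℓ)}
    (hZ : ∀ ℓ, HasLaw (Z ℓ) (stdGaussian (Vec (p ℓ))) P') (hZindep : iIndepFun Z P')
    (a : Fin 2 → ℝ) (t : PiLp 2 fun ℓ => Vec (p ℓ)) :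
    charFun (P'.map fun ω => WithLp.toLp 2 fun ℓ => a ℓ • invSqrtApply (S ℓ) (Z ℓ ω)) t =
      Complex.exp (-((∑ ℓ, a ℓ ^ 2 * ((t ℓ).ofLp ⬝ᵥ (S ℓ)⁻¹.mulVec (t ℓ).ofLp)) / 2 : ℝ)) := by
  have hZm : ∀ ℓ, AEMeasurable (Z ℓ) P' := fun ℓ => (hZ ℓ).aemeasurable
  have hW : AEMeasurable (fun ω => (WithLp.toLp 2 fun ℓ => a ℓ • invSqrtApply (S ℓ) (Z ℓ ω) :
      PiLp 2 fun ℓ => Vec (p ℓ))) P' :=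
    (WithLp.measurable_toLp 2 _).comp_aemeasurable (aemeasurable_pi_lambda _ fun ℓ =>
      ((measurable_invSqrtApply (S ℓ)).comp_aemeasurable (hZm ℓ)).const_smul (a ℓ))
  have hinner : ∀ ℓ, Measurable fun z : Vec (p ℓ) => inner ℝ z (a ℓ • invSqrtApply (S ℓ) (t ℓ)) :=
    fun ℓ => (continuous_id.inner continuous_const).measurable
  have hsum : (fun ω => inner ℝ (WithLp.toLp 2 fun ℓ => a ℓ • invSqrtApply (S ℓ) (Z ℓ ω) :
      PiLp 2 fun ℓ => Vec (p ℓ)) t) =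
      fun ω => ∑ ℓ, inner ℝ (Z ℓ ω) (a ℓ • invSqrtApply (S ℓ) (t ℓ)) := by
    ext ω
    rw [PiLp.inner_apply]
    refine Finset.sum_congr rfl fun ℓ _ => ?_
    rw [real_inner_smul_left, real_inner_smul_right, inner_invSqrtApply_left]
  have hind : iIndepFun (fun ℓ ω => inner ℝ (Z ℓ ω) (a ℓ • invSqrtApply (S ℓ) (t ℓ))) P' :=
    hZindep.comp _ hinner
  have hindm : ∀ ℓ, AEMeasurable
      (fun ω => inner ℝ (Z ℓ ω) (a ℓ • invSqrtApply (S ℓ) (t ℓ))) P' :=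
    fun ℓ => (hinner ℓ).comp_aemeasurable (hZm ℓ)
  rw [charFun_map_eq_charFun_map_inner hW, hsum,
    (hind.restrict Finset.univ).charFun_map_fun_finsetSum_eq_prod (fun ℓ _ => hindm ℓ),
    Finset.prod_apply]
  have hfac : ∀ ℓ, charFun (P'.map fun ω => inner ℝ (Z ℓ ω) (a ℓ • invSqrtApply (S ℓ) (t ℓ))) 1 =
      Complex.exp (-((a ℓ ^ 2 * ((t ℓ).ofLp ⬝ᵥ (S ℓ)⁻¹.mulVec (t ℓ).ofLp) / 2 : ℝ) : ℂ)) := by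
    intro ℓ
    rw [← charFun_map_eq_charFun_map_inner (hZm ℓ), (hZ ℓ).map_eq, charFun_stdGaussian,
      ← norm_invSqrtApply_sq (hS ℓ), norm_smul, Real.norm_eq_abs]
    congr 1
    rw [← sq_abs (a ℓ)]
    push_cast
    ring
  refine (Finset.prod_congr rfl fun ℓ _ => hfac ℓ).trans ?_
  rw [← Complex.exp_sum]
  congr 1
  push_cast
  rw [Finset.sum_neg_distrib, Finset.sum_div]

variable [IsProbabilityMeasure P']

/-- Joint central limit theorem for the sums of the influence functions of both groups. -/
lemma tendstoInDistribution_influence_sums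
    {ψ : (ℓ : Fin 2) → Fin (k ℓ) → ℕ → Ω → Vec (p ℓ)}
    (hindep : iIndepFun
      (fun s : (ℓ : Fin 2) × (Fin (k ℓ) × ℕ) => ψ s.1 s.2.1 s.2.2) P)
    (hident : ∀ ℓ i j, IdentDistrib (ψ ℓ i j) (ψ ℓ i 0) P P)
    (hLp : ∀ ℓ i, MemLp (ψ ℓ i 0) 2 P) (hmean : ∀ ℓ i, ∫ ω, ψ ℓ i 0 ω ∂P = 0)
    {S : (ℓ : Fin 2) → Matrix (Fin (p ℓ)) (Fin (p ℓ)) ℝ} (hS : ∀ ℓ, (S ℓ).PosSemidef)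
    {ζ : (ℓ : Fin 2) → Fin (k ℓ) → ℝ} (hζ : ∀ ℓ i, 0 ≤ ζ ℓ i)
    (hcov : ∀ ℓ, (S ℓ)⁻¹ = ∑ i, ζ ℓ i •
      Matrix.of (fun a b => ∫ ω, ψ ℓ i 0 ω a * ψ ℓ i 0 ω b ∂P))
    {N : (ℓ : Fin 2) → ℕ → Fin (k ℓ) → ℕ} (hN : ∀ ℓ i, Tendsto (fun r => N ℓ r i) atTop atTop)
    {c : ℕ → Fin 2 → ℝ} {a : Fin 2 → ℝ}
    (hc : ∀ ℓ i, Tendsto (fun r => √(N ℓ r i : ℝ) * c r ℓ) atTop (𝓝 (a ℓ * √(ζ ℓ i))))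
    {Z : (ℓ : Fin 2) → Ω' → Vec (p ℓ)}
    (hZ : ∀ ℓ, HasLaw (Z ℓ) (stdGaussian (Vec (p ℓ))) P') (hZindep : iIndepFun Z P') :
    TendstoInDistribution
      (fun r ω => (WithLp.toLp 2 fun ℓ =>
        c r ℓ • ∑ i, ∑ j ∈ Finset.range (N ℓ r i), ψ ℓ i j ω : PiLp 2 fun ℓ => Vec (p ℓ)))
      atTop (fun ω => WithLp.toLp 2 fun ℓ => a ℓ • invSqrtApply (S ℓ) (Z ℓ ω))
      (fun _ => P) P' := by
  have hψ : ∀ ℓ i j, AEMeasurable (ψ ℓ i j) P := fun ℓ i j => (hident ℓ i j).aemeasurable_fst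
  have hmeas : ∀ r, AEMeasurable (fun ω => (WithLp.toLp 2 fun ℓ =>
      c r ℓ • ∑ i, ∑ j ∈ Finset.range (N ℓ r i), ψ ℓ i j ω : PiLp 2 fun ℓ => Vec (p ℓ))) P :=
    fun r => (WithLp.measurable_toLp 2 _).comp_aemeasurable (aemeasurable_pi_lambda _ fun ℓ =>
      (Finset.aemeasurable_fun_sum _ fun i _ =>
        Finset.aemeasurable_fun_sum _ fun j _ => hψ ℓ i j).const_smul (c r ℓ))
  have hW : AEMeasurable (fun ω => (WithLp.toLp 2 fun ℓ => a ℓ • invSqrtApply (S ℓ) (Z ℓ ω) :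
      PiLp 2 fun ℓ => Vec (p ℓ))) P' :=
    (WithLp.measurable_toLp 2 _).comp_aemeasurable (aemeasurable_pi_lambda _ fun ℓ =>
      ((measurable_invSqrtApply (S ℓ)).comp_aemeasurable (hZ ℓ).aemeasurable).const_smul (a ℓ))
  refine ⟨hmeas, hW, ProbabilityMeasure.tendsto_iff_tendsto_charFun.2 fun t => ?_⟩
  simp only [ProbabilityMeasure.coe_mk]
  rw [charFun_map_toLp_smul_invSqrtApply hS hZ hZindep a t]
  have hinner : ∀ ℓ, Measurable fun z : Vec (p ℓ) => inner ℝ z (t ℓ) :=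
    fun ℓ => (continuous_id.inner continuous_const).measurable
  have hind : iIndepFun (fun (s : (_ : (ℓ : Fin 2) × Fin (k ℓ)) × ℕ) ω =>
      inner ℝ (ψ s.1.1 s.1.2 s.2 ω) (t s.1.1)) P := by
    have h := (hindep.comp (fun s z => inner ℝ z (t s.1)) fun s => hinner s.1).precomp
      (g := fun s : (_ : (ℓ : Fin 2) × Fin (k ℓ)) × ℕ =>
        (⟨s.1.1, (s.1.2, s.2)⟩ : (ℓ : Fin 2) × (Fin (k ℓ) × ℕ))) (by
        rintro ⟨⟨ℓ, i⟩, j⟩ ⟨⟨ℓ', i'⟩, j'⟩ h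
        simp only [Sigma.mk.injEq] at h
        obtain ⟨rfl, h⟩ := h
        simp only [heq_eq_eq, Prod.mk.injEq] at h
        obtain ⟨rfl, rfl⟩ := h
        rfl)
    exact h
  have key := tendsto_charFun_sum_blocks
    (ξ := fun (e : (ℓ : Fin 2) × Fin (k ℓ)) j ω => inner ℝ (ψ e.1 e.2 j ω) (t e.1)) hind
    (fun e j => (hident e.1 e.2 j).comp (hinner e.1))
    (fun e => (hLp e.1 e.2).inner_const (t e.1))
    (fun e => by
      simp_rw [real_inner_comm (t e.1)]
      rw [integral_inner ((hLp e.1 e.2).integrable (by norm_num)), hmean, inner_zero_right])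
    (M := fun r e => N e.1 r e.2) (fun e => hN e.1 e.2)
    (c := fun r e => c r e.1) (s := fun e => a e.1 * √(ζ e.1 e.2)) (fun e => hc e.1 e.2)
  have hlim : (∑ e : (ℓ : Fin 2) × Fin (k ℓ), (a e.1 * √(ζ e.1 e.2)) ^ 2 *
      variance (fun ω => inner ℝ (ψ e.1 e.2 0 ω) (t e.1)) P) =
      ∑ ℓ, a ℓ ^ 2 * ((t ℓ).ofLp ⬝ᵥ (S ℓ)⁻¹.mulVec (t ℓ).ofLp) := by
    rw [Fintype.sum_sigma]
    refine Finset.sum_congr rfl fun ℓ _ => ?_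
    rw [hcov, Matrix.sum_mulVec, dotProduct_sum, Finset.mul_sum]
    refine Finset.sum_congr rfl fun i _ => ?_
    rw [variance_inner_eq_sum (hLp ℓ i) (hmean ℓ i), Matrix.smul_mulVec, dotProduct_smul,
      mul_pow, Real.sq_sqrt (hζ ℓ i), smul_eq_mul, mul_assoc]
  -- The characteristic function at `t` is that of the linear form `⟪·, t⟫` at `1`, a weighted sum
  -- over the blocks indexed by the groups and their design points.
  rw [hlim] at key
  refine key.congr fun r => ?_
  rw [charFun_map_eq_charFun_map_inner (hmeas r)]
  congr 2
  ext ω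
  rw [PiLp.inner_apply, Fintype.sum_sigma]
  refine Finset.sum_congr rfl fun ℓ _ => ?_
  simp only [real_inner_smul_left, sum_inner, Finset.mul_sum]

end

/-! ### The limit process -/

section

variable {Ω' : Type*} [MeasurableSpace Ω'] {P' : Measure Ω'} {d : ℕ} {X : Set (Vec d)}
  {p : Fin 2 → ℕ} {m : (ℓ : Fin 2) → Vec d → Vec (p ℓ) → ℝ} {B : (ℓ : Fin 2) → Set (Vec (p ℓ))}
  {β : (ℓ : Fin 2) → Vec (p ℓ)}

/-- The linear map that turns a pair of standard normal vectors into the limit of the rescaled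
estimation errors of both groups. -/
noncomputable def limitErrorMap (S : (ℓ : Fin 2) → Matrix (Fin (p ℓ)) (Fin (p ℓ)) ℝ)
    (a : Fin 2 → ℝ) : ((ℓ : Fin 2) → Vec (p ℓ)) →L[ℝ] PiLp 2 fun ℓ => Vec (p ℓ) :=
  (PiLp.continuousLinearEquiv 2 ℝ fun ℓ => Vec (p ℓ)).symm.toContinuousLinearMap.comp
    (ContinuousLinearMap.pi fun ℓ => a ℓ •
      (Matrix.toEuclideanCLM (𝕜 := ℝ) (CFC.sqrt (S ℓ)⁻¹)).comp (ContinuousLinearMap.proj ℓ))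

lemma limitErrorMap_apply (S : (ℓ : Fin 2) → Matrix (Fin (p ℓ)) (Fin (p ℓ)) ℝ)
    (a : Fin 2 → ℝ) (z : (ℓ : Fin 2) → Vec (p ℓ)) :
    limitErrorMap S a z = WithLp.toLp 2 fun ℓ => a ℓ • invSqrtApply (S ℓ) (z ℓ) := rfl

lemma limitCurve_eq_curveDifferential (S : (ℓ : Fin 2) → Matrix (Fin (p ℓ)) (Fin (p ℓ)) ℝ)
    (κ : ℝ) (z : (ℓ : Fin 2) → Vec (p ℓ)) (x : Vec d) :
    limitCurve (m 0) (m 1) (β 0) (β 1) (S 0) (S 1) κ (z 0) (z 1) x =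
      curveDifferential m β x (limitErrorMap S ![√κ, √(κ / (κ - 1))] z) := by
  rw [curveDifferential_apply, limitErrorMap_apply, limitCurve, inner_gradient_eq_fderiv,
    inner_gradient_eq_fderiv]
  rfl

lemma hasGaussianLaw_pair {Z : (ℓ : Fin 2) → Ω' → Vec (p ℓ)}
    (hZ : ∀ ℓ, HasLaw (Z ℓ) (stdGaussian (Vec (p ℓ))) P') (hZindep : iIndepFun Z P') :
    HasGaussianLaw (fun ω ℓ => Z ℓ ω) P' :=
  hZindep.hasGaussianLaw fun ℓ => (hZ ℓ).hasGaussianLaw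

lemma isGaussianProcess_linear_image {T E : Type*} [NormedAddCommGroup E] [NormedSpace ℝ E]
    [MeasurableSpace E] [BorelSpace E] {W : Ω' → E} (hW : HasGaussianLaw W P')
    (L : T → E →L[ℝ] ℝ) : IsGaussianProcess (fun t ω => L t (W ω)) P' :=
  ⟨fun I => hW.map (ContinuousLinearMap.pi fun t : I => L t)⟩

lemma integral_linear_pair_eq_zero {Z : (ℓ : Fin 2) → Ω' → Vec (p ℓ)}
    (hZ : ∀ ℓ, HasLaw (Z ℓ) (stdGaussian (Vec (p ℓ))) P') (hZindep : iIndepFun Z P')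
    (L : ((ℓ : Fin 2) → Vec (p ℓ)) →L[ℝ] ℝ) : ∫ ω, L (fun ℓ => Z ℓ ω) ∂P' = 0 := by
  have hint := (hasGaussianLaw_pair hZ hZindep).integrable
  have hzero : ∫ ω, (fun ℓ => Z ℓ ω) ∂P' = 0 := by
    ext1 ℓ
    rw [eval_integral fun ℓ => hint.eval ℓ, (hZ ℓ).integral_eq, integral_id_stdGaussian]
    rfl
  rw [L.integral_comp_comm hint, hzero, map_zero]

end

/-! ### From the linearization to the estimators -/

section

variable {Ω : Type*} [MeasurableSpace Ω] {P : Measure Ω} {p : Fin 2 → ℕ}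

/-- A pair of sequences that vanish in probability still vanishes after rescaling by convergent
factors. -/
lemma tendstoInMeasure_toLp_smul {V : (ℓ : Fin 2) → ℕ → Ω → Vec (p ℓ)}
    (hV : ∀ ℓ, TendstoInMeasure P (V ℓ) atTop (fun _ => 0)) {b : ℕ → Fin 2 → ℝ} {a : Fin 2 → ℝ}
    (hb : ∀ ℓ, Tendsto (fun r => b r ℓ) atTop (𝓝 (a ℓ))) :
    TendstoInMeasure P (fun r ω => (WithLp.toLp 2 fun ℓ => b r ℓ • V ℓ r ω :
      PiLp 2 fun ℓ => Vec (p ℓ))) atTop (fun _ => 0) := by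
  rw [tendstoInMeasure_iff_norm]
  intro ε hε
  set C : ℝ := |a 0| + |a 1| + 1 with hC
  have hCpos : 0 < C := by positivity
  have hbC : ∀ ℓ, ∀ᶠ r in atTop, |b r ℓ| < C := fun ℓ => by
    refine (hb ℓ).abs.eventually_lt_const ?_
    have h0 := abs_nonneg (a 0)
    have h1 := abs_nonneg (a 1)
    fin_cases ℓ <;> simp only [hC, Fin.zero_eta, Fin.mk_one] <;> linarith
  have hV' : ∀ ℓ, Tendsto (fun r => P {ω | ε / (2 * C) ≤ ‖V ℓ r ω - 0‖}) atTop (𝓝 0) :=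
    fun ℓ => tendstoInMeasure_iff_norm.1 (hV ℓ) _ (by positivity)
  have hsum := (hV' 0).add (hV' 1)
  rw [add_zero] at hsum
  refine tendsto_of_tendsto_of_tendsto_of_le_of_le' tendsto_const_nhds hsum
    (.of_forall fun _ => zero_le) ?_
  filter_upwards [hbC 0, hbC 1] with r h0 h1
  refine (measure_mono fun ω hω => ?_).trans (measure_union_le _ _)
  by_contra hcon
  simp only [Set.mem_union, Set.mem_ofPred_eq, not_or, not_le, sub_zero] at hcon hω
  have hle : ∀ ℓ, |b r ℓ| < C → ‖V ℓ r ω‖ < ε / (2 * C) → ‖b r ℓ • V ℓ r ω‖ < ε / 2 := by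
    intro ℓ h h'
    rw [norm_smul, Real.norm_eq_abs]
    calc _ ≤ C * ‖V ℓ r ω‖ := mul_le_mul_of_nonneg_right h.le (norm_nonneg _)
      _ < C * (ε / (2 * C)) := mul_lt_mul_of_pos_left h' hCpos
      _ = ε / 2 := by field_simp
  have hn := PiLp.norm_sq_eq_of_L2 (fun ℓ => Vec (p ℓ))
    (WithLp.toLp 2 fun ℓ => b r ℓ • V ℓ r ω)
  rw [Fin.sum_univ_two] at hn
  have e0 := hle 0 h0 hcon.1
  have e1 := hle 1 h1 hcon.2
  have p0 := norm_nonneg (b r 0 • V 0 r ω)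
  have p1 := norm_nonneg (b r 1 • V 1 r ω)
  simp only at hn
  -- The `ℓ²` norm is at least `ε`, but both components are smaller than `ε / 2`.
  nlinarith

end

section

variable {N : ℕ → ℕ} {s : ℕ → ℕ}

lemma tendsto_atTop_of_tendsto_div {z : ℝ} (hz : 0 < z) (hs : Tendsto s atTop atTop)
    (h : Tendsto (fun r => (N r : ℝ) / (s r : ℝ)) atTop (𝓝 z)) : Tendsto N atTop atTop := by
  have h1 := h.pos_mul_atTop hz (tendsto_natCast_atTop_atTop.comp hs : Tendsto
    (fun r => ((s r : ℕ) : ℝ)) atTop atTop)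
  refine tendsto_natCast_atTop_iff.1 (h1.congr' ?_)
  filter_upwards [hs.eventually_gt_atTop 0] with r hr
  have : (s r : ℝ) ≠ 0 := by positivity
  simp only [Function.comp_apply]
  field_simp

/-- If `n / n₁ → κ`, then `n / n₂ → κ / (κ - 1)`, as `n = n₁ + n₂`. -/
lemma tendsto_total_div_snd {κ : ℝ} (hκ : 1 < κ) (hN : Tendsto N atTop atTop)
    (h : Tendsto (fun r => ((N r + s r : ℕ) : ℝ) / (N r : ℝ)) atTop (𝓝 κ)) :
    Tendsto (fun r => ((N r + s r : ℕ) : ℝ) / (s r : ℝ)) atTop (𝓝 (κ / (κ - 1))) := by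
  refine (h.div (h.sub_const 1) (sub_pos.2 hκ).ne').congr' ?_
  filter_upwards [hN.eventually_gt_atTop 0] with r hr
  have : (N r : ℝ) ≠ 0 := by positivity
  simp only [Pi.div_apply]
  push_cast
  rw [div_sub_one this, add_sub_cancel_left, div_div_div_cancel_right₀ this]

end

/-! ### Asymptotic law of the estimated area -/

theorem theorem2p1
    {Ω : Type*} [MeasurableSpace Ω] (P : Measure Ω) [IsProbabilityMeasure P]
    {Ω' : Type*} [MeasurableSpace Ω'] (P' : Measure Ω') [IsProbabilityMeasure P']
    -- covariate region, dimensions, design points, regression functions, parameters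
    {d : ℕ} (X : Set (Vec d)) (p k : Fin 2 → ℕ)
    (x : (ℓ : Fin 2) → Fin (k ℓ) → Vec d)
    (m : (ℓ : Fin 2) → Vec d → Vec (p ℓ) → ℝ)
    (B : (ℓ : Fin 2) → Set (Vec (p ℓ))) (β : (ℓ : Fin 2) → Vec (p ℓ))
    -- errors and their standard deviations, allocations at stage `r`, limiting proportions
    (η : (ℓ : Fin 2) → Fin (k ℓ) → ℕ → Ω → ℝ) (σ : Fin 2 → ℝ)
    (N : (ℓ : Fin 2) → ℕ → Fin (k ℓ) → ℕ) (ζ : (ℓ : Fin 2) → Fin (k ℓ) → ℝ) (κ : ℝ)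
    -- estimators, as functions of the sample, and their influence functions
    (est : (ℓ : Fin 2) → (r : ℕ) → ((i : Fin (k ℓ)) → Fin (N ℓ r i) → ℝ) → Vec (p ℓ))
    (φ : (ℓ : Fin 2) → Fin (k ℓ) → ℕ → ℝ → Vec (p ℓ))
    -- the standard normal vectors of the limit
    (Z : (ℓ : Fin 2) → Ω' → Vec (p ℓ))
    -- independent errors, identically distributed in each group, with mean 0, variance `σ ℓ ^ 2`
    (hη_meas : ∀ ℓ i j, Measurable (η ℓ i j))
    (hη_indep : iIndepFun
      (fun s : (ℓ : Fin 2) × (Fin (k ℓ) × ℕ) => η s.1 s.2.1 s.2.2) P)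
    (hη_ident : ∀ ℓ i j i' j', IdentDistrib (η ℓ i j) (η ℓ i' j') P P)
    (hη_memLp : ∀ ℓ i j, MemLp (η ℓ i j) 2 P)
    (hη_mean : ∀ ℓ i j, ∫ ω, η ℓ i j ω ∂P = 0)
    (hη_var : ∀ ℓ i j, variance (η ℓ i j) P = σ ℓ ^ 2)
    (hσ : ∀ ℓ, 0 < σ ℓ)
    -- compact covariate region that contains the design points
    (hX : IsCompact X) (hx : ∀ ℓ i, x ℓ i ∈ X)
    -- compact parameter sets, in which the estimators take their values
    (hB : ∀ ℓ, IsCompact (B ℓ)) (hβ : ∀ ℓ, β ℓ ∈ B ℓ)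
    (hest_meas : ∀ ℓ r, Measurable (est ℓ r)) (hest : ∀ ℓ r y, est ℓ r y ∈ B ℓ)
    -- regularity and identifiability
    (hm : ∀ ℓ, IsRegularRegression X (B ℓ) (β ℓ) (m ℓ))
    (hid : ∀ ℓ, IsIdentifiable (B ℓ) (m ℓ) (x ℓ) (N ℓ))
    -- non-singular matrices and sample sizes
    (hS : ∀ ℓ, IsUnit (informationMatrix (m ℓ) (x ℓ) (ζ ℓ) (σ ℓ) (β ℓ)).det)
    (hN : ∀ ℓ, Tendsto (fun r => sampleSize (N ℓ r)) atTop atTop)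
    (hζ_pos : ∀ ℓ i, 0 < ζ ℓ i)
    (hζ : ∀ ℓ i, Tendsto (fun r => (N ℓ r i : ℝ) / (sampleSize (N ℓ r) : ℝ)) atTop (𝓝 (ζ ℓ i)))
    (hκ_one : 1 < κ)
    (hκ : Tendsto (fun r => ((sampleSize (N 0 r) + sampleSize (N 1 r) : ℕ) : ℝ) /
      (sampleSize (N 0 r) : ℝ)) atTop (𝓝 κ))
    -- linearization of the estimators
    (hlin : ∀ ℓ, IsAsymptoticallyLinear P
      (fun i j ω => response (m ℓ) (β ℓ) (x ℓ i) (η ℓ i j ω)) (N ℓ) (ζ ℓ) (β ℓ) (est ℓ) (φ ℓ)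
      (informationMatrix (m ℓ) (x ℓ) (ζ ℓ) (σ ℓ) (β ℓ))⁻¹)
    -- independent standard normal vectors
    (hZ_law : ∀ ℓ, HasLaw (Z ℓ) (stdGaussian (Vec (p ℓ))) P')
    (hZ_indep : iIndepFun Z P') :
    let S : (ℓ : Fin 2) → Matrix (Fin (p ℓ)) (Fin (p ℓ)) ℝ :=
      fun ℓ => informationMatrix (m ℓ) (x ℓ) (ζ ℓ) (σ ℓ) (β ℓ)
    let n : ℕ → ℕ := fun r => sampleSize (N 0 r) + sampleSize (N 1 r)
    let βhat : (ℓ : Fin 2) → ℕ → Ω → Vec (p ℓ) := fun ℓ r ω =>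
      est ℓ r (fun i j => response (m ℓ) (β ℓ) (x ℓ i) (η ℓ i j ω))
    let G : Vec d → Ω' → ℝ := fun t ω =>
      limitCurve (m 0) (m 1) (β 0) (β 1) (S 0) (S 1) κ (Z 0 ω) (Z 1 ω) t
    -- `G` is a centred Gaussian process with bounded paths
    (IsGaussianProcess (fun (t : X) ω => G t ω) P' ∧
      (∀ t ∈ X, ∫ ω, G t ω ∂P' = 0) ∧
      (∀ ω, ∃ C : ℝ, ∀ t ∈ X, |G t ω| ≤ C)) ∧
    TendstoInDistribution
      (fun r ω => √(n r : ℝ) *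
        (areaBetween X (m 0) (m 1) (βhat 0 r ω) (βhat 1 r ω) -
          areaBetween X (m 0) (m 1) (β 0) (β 1)))
      atTop
      (fun ω => directionalArea X (m 0) (m 1) (β 0) (β 1) (fun t => G t ω))
      (fun _ => P) P' := by
  intro S n βhat G
  have hψm : ∀ ℓ i, Measurable (response (m ℓ) (β ℓ) (x ℓ i)) := fun ℓ i =>
    measurable_const.add measurable_id
  have hGeq : ∀ ω t, G t ω =
      curveDifferential m β t (limitErrorMap S ![√κ, √(κ / (κ - 1))] fun ℓ => Z ℓ ω) :=
    fun ω t => limitCurve_eq_curveDifferential S κ (fun ℓ => Z ℓ ω) t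
  obtain ⟨C, hC⟩ := exists_norm_curveDifferential_le hX hm
  refine ⟨⟨?_, fun t ht => ?_, fun ω => ?_⟩, ?_⟩
  · simp only [hGeq]
    exact isGaussianProcess_linear_image (hasGaussianLaw_pair hZ_law hZ_indep)
      fun t : X => (curveDifferential m β (t : Vec d)).comp
        (limitErrorMap S ![√κ, √(κ / (κ - 1))])
  · simp only [hGeq]
    exact integral_linear_pair_eq_zero hZ_law hZ_indep
      ((curveDifferential m β t).comp (limitErrorMap S ![√κ, √(κ / (κ - 1))]))
  · refine ⟨C * ‖limitErrorMap S ![√κ, √(κ / (κ - 1))] fun ℓ => Z ℓ ω‖, fun t ht => ?_⟩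
    rw [hGeq]
    exact ContinuousLinearMap.le_of_opNorm_le _ (hC t ht) _
  set a : Fin 2 → ℝ := ![√κ, √(κ / (κ - 1))]
  let ψ : (ℓ : Fin 2) → Fin (k ℓ) → ℕ → Ω → Vec (p ℓ) := fun ℓ i j ω =>
    φ ℓ i j (response (m ℓ) (β ℓ) (x ℓ i) (η ℓ i j ω))
  -- `b r ℓ` rescales errors of order `√(n ℓ)` to the common order `√n`.
  let b : ℕ → Fin 2 → ℝ := fun r ℓ => √((n r : ℝ) / (sampleSize (N ℓ r) : ℝ))
  have hb : ∀ ℓ, Tendsto (fun r => b r ℓ) atTop (𝓝 (a ℓ)) := by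
    intro ℓ
    fin_cases ℓ
    · exact hκ.sqrt
    · exact (tendsto_total_div_snd hκ_one (hN 0) hκ).sqrt
  have hbeq : ∀ r ℓ, b r ℓ * (1 / √(sampleSize (N ℓ r) : ℝ)) =
      √(n r : ℝ) / (sampleSize (N ℓ r) : ℝ) := fun r ℓ => by
    simp only [b]
    rw [Real.sqrt_div (Nat.cast_nonneg _), div_mul_div_comm, mul_one,
      Real.mul_self_sqrt (Nat.cast_nonneg _)]
  have hclt := tendstoInDistribution_influence_sums (P := P) (P' := P') (ψ := ψ) (S := S)
    (c := fun r ℓ => √(n r : ℝ) / (sampleSize (N ℓ r) : ℝ)) (a := a) (ζ := ζ) (N := N) (Z := Z)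
    (hη_indep.comp (fun s e => φ s.1 s.2.1 s.2.2 (response (m s.1) (β s.1) (x s.1 s.2.1) e))
      fun s => ((hlin s.1).measurable _ _).comp (hψm _ _))
    (fun ℓ i j => (hlin ℓ).identDistrib i j 0) (fun ℓ i => (hlin ℓ).memLp i 0)
    (fun ℓ i => (hlin ℓ).centred i 0)
    (fun ℓ => posSemidef_informationMatrix _ _ (fun i => (hζ_pos ℓ i).le) _ _)
    (fun ℓ i => (hζ_pos ℓ i).le) (fun ℓ => (hlin ℓ).covariance 0)
    (fun ℓ i => tendsto_atTop_of_tendsto_div (hζ_pos ℓ i) (hN ℓ) (hζ ℓ i))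
    (fun ℓ i => by
      refine ((hb ℓ).mul (hζ ℓ i).sqrt).congr fun r => ?_
      rw [← hbeq, Real.sqrt_div (Nat.cast_nonneg _)]
      ring)
    hZ_law hZ_indep
  have hβm : ∀ ℓ r, Measurable (βhat ℓ r) := fun ℓ r =>
    (hest_meas ℓ r).comp (measurable_pi_lambda _ fun i => measurable_pi_lambda _ fun j =>
      (hψm ℓ i).comp (hη_meas ℓ i j))
  -- The delta method is applied to the pair of estimation errors.
  let θ : ℕ → Ω → PiLp 2 (fun ℓ => Vec (p ℓ)) := fun r ω =>
    WithLp.toLp 2 fun ℓ => βhat ℓ r ω - β ℓ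
  have hθm : ∀ r, Measurable (θ r) := fun r =>
    (WithLp.measurable_toLp 2 _).comp (measurable_pi_lambda _ fun ℓ => (hβm ℓ r).sub_const _)
  have hθ : TendstoInDistribution (fun r ω => √(n r : ℝ) • θ r ω) atTop
      (fun ω => limitErrorMap S a fun ℓ => Z ℓ ω) (fun _ => P) P' := by
    -- For positive group sizes the difference to the influence sums is `b r ℓ` times the remainder
    -- of the linearization of group `ℓ`.
    refine tendstoInDistribution_of_tendstoInMeasure_sub _ _ hclt ?_
      fun r => ((hθm r).const_smul (√(n r : ℝ))).aemeasurable
    refine (tendstoInMeasure_toLp_smul (fun ℓ => (hlin ℓ).linearization) hb).congr' ?_ .rfl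
    filter_upwards [(hN 0).eventually_gt_atTop 0, (hN 1).eventually_gt_atTop 0] with r h0 h1
    refine .of_forall fun ω => ?_
    ext1 ℓ
    have hpos : 0 < sampleSize (N ℓ r) := by fin_cases ℓ <;> assumption
    have hpos' : √(sampleSize (N ℓ r) : ℝ) ≠ 0 := by positivity
    have hroot : b r ℓ * √(sampleSize (N ℓ r) : ℝ) = √(n r : ℝ) := by
      simp only [b]
      rw [Real.sqrt_div (Nat.cast_nonneg _), div_mul_cancel₀ _ hpos']
    change b r ℓ • (_ - _) = √(n r : ℝ) • (βhat ℓ r ω - β ℓ) - _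
    rw [smul_sub, smul_smul, smul_smul, hroot, hbeq]
    rfl
  have hn : Tendsto (fun r => √(n r : ℝ)) atTop atTop :=
    Real.tendsto_sqrt_atTop.comp (tendsto_natCast_atTop_atTop.comp
      (tendsto_atTop_mono (fun r => Nat.le_add_right _ _) (hN 0)))
  have hdelta := tendstoInDistribution_delta_method
    (F := fun v : PiLp 2 (fun ℓ => Vec (p ℓ)) =>
      areaBetween X (m 0) (m 1) (β 0 + v 0) (β 1 + v 1))
    (continuous_directionalArea_curveDifferential hX hm)
    (directionalArea_curveDifferential_smul hX hm) (isLittleO_areaBetween hX hm) hn hθ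
    (by
      simp only [θ, add_sub_cancel, PiLp.zero_apply, add_zero]
      exact fun r => (((measurable_areaBetween_comp hX hB hm (fun ℓ => hβm ℓ r)
        fun ℓ ω => hest ℓ r _).sub_const _).const_mul _).aemeasurable)
  simp only [θ, add_sub_cancel, PiLp.zero_apply, add_zero] at hdelta
  simp only [hGeq]
  exact hdelta
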